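/- Let $A$ be an alphabet (a finite set) and let $L \subseteq A^+$ be a language of nonempty finite words over $A$. Then $L$ is $\mathsf{FO}(<)$-definable if and only if $L$ is $\mathsf{LTL}$-definable. Here $L$ is *$\mathsf{FO}(<)$-definable* if $L=\{w\in A^+ \mid w\models\varphi\}$ for some sentence $\varphi$ of first-order logic with equality in the signature consisting of a binary predicate $<$ and a unary predicate $\boldsymbol a$ for each $a\in A$; a word $w$ is regarded as a structure with domain $\{0,\dots,|w|-1\}$, in which $<$ is the usual strict order and $\boldsymbol a$ is the set of positions of $w$ that carry the symbol $a$. $\mathsf{LTL}$-formulas are built from propositional variables $p_0,p_1,\dots$ by the Booleans and the temporal operators $\bigcirc$, $\Diamond$, $\mathbin{\mathcal U}$. They are interpreted at the points of a temporal model $\mathfrak M=(\{0,\dots,\ell\},<,V)$, where $V(p_i)\subseteq\{0,\dots,\ell\}$ for every $i$, under the strict semantics: $\mathfrak M,n\models p_i$ iff $n\in V(p_i)$; $\mathfrak M,n\models\bigcirc\varphi$ iff $n<\ell$ and $\mathfrak M,n+1\models\varphi$; $\mathfrak M,n\models\Diamond\varphi$ iff $\mathfrak M,m\models\varphi$ for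 some $m$ with $n<m\le\ell$; $\mathfrak M,n\models\varphi\mathbin{\mathcal U}\psi$ iff there is $m$ with $n<m\le\ell$, $\mathfrak M,m\models\varphi$, and $\mathfrak M,k\models\psi$ for all $k$ with $n<k<m$; the Booleans are interpreted as usual. The symbols of $A$ are identified with pairwise distinct propositional variables by a fixed but arbitrary injection of $A$ into $\{p_0,p_1,\dots\}$. A word $w=a_0\dots a_\ell\in A^+$ is then regarded as the temporal model on $\{0,\dots,\ell\}$ in which the variable of a symbol $a$ is true exactly at the positions $n$ with $a_n=a$, and a variable that is not a symbol of $A$ is true nowhere. The language $L$ is *$\mathsf{LTL}$-definable* if $L=\{w\in A^+\mid w,0\models\varphi\}$ for some $\mathsf{LTL}$-formula $\varphi$. -/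

import Mathlib

universe u

/-! ### Linear temporal logic over finite timelines -/

/-- `LTL`-formulas over the countably infinite supply `p₀, p₁, …` of propositional variables,
indexed by `ℕ`. The remaining Booleans are abbreviations. -/
inductive LTLFormula : Type
  | top : LTLFormula
  | var (i : ℕ) : LTLFormula
  | neg (φ : LTLFormula) : LTLFormula
  | and (φ ψ : LTLFormula) : LTLFormula
  /-- `○ φ`: at the next moment. -/
  | next (φ : LTLFormula) : LTLFormula
  /-- `◇ φ`: some time in the (strict) future. -/
  | eventually (φ : LTLFormula) : LTLFormula
  /-- `φ 𝒰 ψ`: at some strictly future moment `φ`, and `ψ` at all moments strictly in between. -/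
  | until (φ ψ : LTLFormula) : LTLFormula

/-- A temporal model `({0, …, ℓ}, <, V)`, where `ℓ = last`. -/
structure TemporalModel where
  last : ℕ
  val : ℕ → Set (Fin (last + 1))

/-- The truth relation `M, n ⊨ φ` under the strict semantics of `◇` and `𝒰`. -/
def TemporalModel.Sat (M : TemporalModel) : Fin (M.last + 1) → LTLFormula → Prop
  | _, .top => True
  | n, .var i => n ∈ M.val i
  | n, .neg φ => ¬ M.Sat n φ
  | n, .and φ ψ => M.Sat n φ ∧ M.Sat n ψ
  | n, .next φ => ∃ h : (n : ℕ) < M.last, M.Sat ⟨n + 1, Nat.succ_lt_succ h⟩ φ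
  | n, .eventually φ => ∃ m, n < m ∧ M.Sat m φ
  | n, .until φ ψ => ∃ m, n < m ∧ M.Sat m φ ∧ ∀ k, n < k → k < m → M.Sat k ψ

/-- A nonempty word `w = a₀ … a_ℓ` as a temporal model. The symbols of the alphabet are regarded
as propositional variables through the injection `e`: the variable of the symbol `a` is true at
exactly those positions that carry `a`, and a variable that is not a symbol is true nowhere.
(Used for nonempty words only.) -/
def wordModel {A : Type u} (e : A ↪ ℕ) (w : List A) : TemporalModel where
  last := w.length - 1
  val i := {n | ∃ a, w[(n : ℕ)]? = some a ∧ e a = i}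

/-- `L = {w ∈ A⁺ | w, 0 ⊨ φ}` for some `LTL`-formula `φ`. -/
def IsLTLDefinable {A : Type u} (e : A ↪ ℕ) (L : Language A) : Prop :=
  ∃ φ : LTLFormula, L = {w : List A | w ≠ [] ∧ (wordModel e w).Sat 0 φ}

/-! ### First-order logic over words -/

/-- The relation symbols of the signature of words over `A`: a binary `<`, and a unary
predicate symbol for every symbol of `A`. -/
inductive WordRel (A : Type u) : ℕ → Type u
  | lt : WordRel A 2
  | letter (a : A) : WordRel A 1

/-- The first-order signature of words over `A`. -/
abbrev wordSignature (A : Type u) : FirstOrder.Language.{0, u} where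
  Functions _ := Empty
  Relations := WordRel A

/-- The interpretation of the relation symbols on the positions of the word `w`: `<` is the strict
order of the positions, and the predicate of `a` selects the positions that carry `a`. -/
def WordRel.Holds {A : Type u} (w : List A) : {n : ℕ} → WordRel A n → (Fin n → Fin w.length) → Prop
  | _, .lt, x => x 0 < x 1
  | _, .letter a, x => w.get (x 0) = a

/-- The word `w` as a first-order structure on its set `{0, …, |w| - 1}` of positions. -/
@[reducible]
def wordStructure {A : Type u} (w : List A) : (wordSignature A).Structure (Fin w.length) where
  funMap f _ := Empty.elim f
  RelMap R x := WordRel.Holds w R x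

/-- The word `w` is a model of the first-order sentence `φ`. -/
def WordModels {A : Type u} (w : List A) (φ : (wordSignature A).Sentence) : Prop :=
  letI := wordStructure w
  FirstOrder.Language.Sentence.Realize (Fin w.length) φ

/-- `L = {w ∈ A⁺ | w ⊨ φ}` for some first-order sentence `φ`. -/
def IsFODefinable {A : Type u} (L : Language A) : Prop :=
  ∃ φ : (wordSignature A).Sentence, L = {w : List A | w ≠ [] ∧ WordModels w φ}

/-!
From `LTL` to first-order logic, the truth relation is transcribed: each temporal operator is
defined by quantifiers over positions (`FODefinableProp.satAt`).

The converse goes through aperiodicity. A first-order formula with `n` free variables defines a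
language over the alphabet `A × 2ⁿ`, where each position carries the variables that name it. By
induction on the formula this language has finitely many left quotients and does not distinguish
large consecutive powers of a word. The only step of substance is the quantifier, that is, the
projection of one marked position (`IsAperiodic.exists_marked`): a mark inside `uᵐ` leaves a large
unmarked power of `u` on one of its sides. Hence the automaton on the left quotients of a
first-order definable language is finite and counter-free.

That in a counter-free automaton the words inducing a given transformation form a temporally
definable language (`FutureDefinable.run_eq`) is shown by Wilke's induction on the number of states
and then on the number of letters. A letter that permutes the states acts trivially, so unless all
letters act trivially, some letter `c` has a proper subset `Q c` of the states `Q` as its image.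
Cut a word at the occurrences of `c`. The pieces do not contain `c`, so the induction on letters
applies to them. Read as letters, the transformations of the pieces between the first and the last
`c` form a word that acts on `Q c`, and this action is again counter-free
(`IsCounterFree.range`), so the induction on states applies. A temporal formula about the word of
pieces is turned into one about the original word by `FutureDefinable.blockMaps_mem`, which uses
that a formula can be relativized to the prefix before the next `c`
(`FutureDefinable.beforeFirst`).

The induction is carried out with a variant of `LTL` evaluated at suffixes of words, the empty
suffix included; `FutureDefinable.exists_formula` translates it to `LTL`.
-/

/-! ### Aperiodic languages of finite index -/

/-- The `m`-fold power of a word. -/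
def wordPow {A : Type*} (x : List A) (m : ℕ) : List A := (List.replicate m x).flatten

theorem wordPow_zero {A : Type*} (x : List A) : wordPow x 0 = [] := rfl

theorem wordPow_succ {A : Type*} (x : List A) (m : ℕ) :
    wordPow x (m + 1) = x ++ wordPow x m := by
  simp [wordPow, List.replicate_succ]

theorem map_wordPow {A B : Type*} (f : A → B) (x : List A) (m : ℕ) :
    (wordPow x m).map f = wordPow (x.map f) m := by
  simp [wordPow, List.map_flatten]

/-- The left quotient `x⁻¹ L`. -/
def leftQuot {A : Type*} (L : Set (List A)) (x : List A) : Set (List A) := {y | x ++ y ∈ L}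

/-- A language is aperiodic when it has finitely many left quotients and cannot distinguish
large consecutive powers of a word in any context. -/
structure IsAperiodic {A : Type*} (L : Set (List A)) : Prop where
  finite_quot : (Set.range (leftQuot L)).Finite
  exists_pow : ∃ n, ∀ m, n ≤ m → ∀ x u y : List A,
    x ++ wordPow u m ++ y ∈ L ↔ x ++ wordPow u (m + 1) ++ y ∈ L

namespace IsAperiodic

variable {A B : Type*}

theorem compl {L : Set (List A)} (h : IsAperiodic L) : IsAperiodic Lᶜ where
  finite_quot := by
    refine (h.finite_quot.image (fun K => Kᶜ)).subset ?_
    rintro _ ⟨x, rfl⟩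
    exact ⟨leftQuot L x, ⟨x, rfl⟩, rfl⟩
  exists_pow := by
    obtain ⟨n, hn⟩ := h.exists_pow
    exact ⟨n, fun m hm x u y => not_congr (hn m hm x u y)⟩

theorem inter {L K : Set (List A)} (h : IsAperiodic L) (h' : IsAperiodic K) :
    IsAperiodic (L ∩ K) where
  finite_quot := by
    refine (h.finite_quot.image2 (fun L' K' => L' ∩ K') h'.finite_quot).subset ?_
    rintro _ ⟨x, rfl⟩
    exact ⟨_, ⟨x, rfl⟩, _, ⟨x, rfl⟩, rfl⟩
  exists_pow := by
    obtain ⟨n, hn⟩ := h.exists_pow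
    obtain ⟨k, hk⟩ := h'.exists_pow
    exact ⟨max n k, fun m hm x u y => and_congr (hn m (le_of_max_le_left hm) x u y)
      (hk m (le_of_max_le_right hm) x u y)⟩

theorem preimage_map (f : A → B) {L : Set (List B)} (h : IsAperiodic L) :
    IsAperiodic {w : List A | w.map f ∈ L} where
  finite_quot := by
    refine (h.finite_quot.image (fun K => {w | w.map f ∈ K})).subset ?_
    rintro _ ⟨x, rfl⟩
    exact ⟨_, ⟨x.map f, rfl⟩, by ext y; simp [leftQuot]⟩
  exists_pow := by
    obtain ⟨n, hn⟩ := h.exists_pow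
    refine ⟨n, fun m hm x u y => ?_⟩
    simpa [map_wordPow] using hn m hm (x.map f) (u.map f) (y.map f)

theorem empty : IsAperiodic (∅ : Set (List A)) where
  finite_quot := (Set.finite_singleton ∅).subset (by rintro _ ⟨x, rfl⟩; rfl)
  exists_pow := ⟨0, by simp⟩

/-- "Some letter satisfies `P`." -/
theorem exists_mem (P : A → Prop) : IsAperiodic {w : List A | ∃ a ∈ w, P a} where
  finite_quot := by
    refine (Set.toFinite {Set.univ, {w : List A | ∃ a ∈ w, P a}}).subset ?_
    rintro _ ⟨x, rfl⟩
    by_cases hx : ∃ a ∈ x, P a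
    · left
      ext y
      simp only [leftQuot, Set.mem_ofPred_eq, Set.mem_univ, iff_true]
      obtain ⟨a, ha, hP⟩ := hx
      exact ⟨a, by simp [ha], hP⟩
    · right
      ext y
      simp only [leftQuot, Set.mem_ofPred_eq, List.mem_append]
      grind
  exists_pow := by
    refine ⟨1, fun m hm x u y => ?_⟩
    obtain ⟨m, rfl⟩ := Nat.exists_eq_add_of_le' hm
    simp only [wordPow_succ, Set.mem_ofPred_eq, List.mem_append]
    grind

/-- "No letter satisfying `P` is followed by a letter satisfying `Q`." -/
theorem pairwise (P Q : A → Prop) :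
    IsAperiodic {w : List A | w.Pairwise fun a b => ¬ (P a ∧ Q b)} where
  finite_quot := by
    refine (Set.toFinite {∅, {w : List A | w.Pairwise fun a b => ¬ (P a ∧ Q b)},
      {w : List A | w.Pairwise (fun a b => ¬ (P a ∧ Q b)) ∧ ∀ b ∈ w, ¬ Q b}}).subset ?_
    rintro _ ⟨x, rfl⟩
    by_cases hx : x.Pairwise fun a b => ¬ (P a ∧ Q b)
    · by_cases hP : ∃ a ∈ x, P a
      · right; right
        ext y
        simp only [leftQuot, Set.mem_ofPred_eq, List.pairwise_append]
        grind
      · right; left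
        ext y
        simp only [leftQuot, Set.mem_ofPred_eq, List.pairwise_append]
        grind
    · left
      ext y
      simp only [leftQuot, Set.mem_ofPred_eq, List.pairwise_append, hx, false_and,
        Set.mem_empty_iff_false]
  exists_pow := by
    refine ⟨2, fun m hm x u y => ?_⟩
    obtain ⟨m, rfl⟩ := Nat.exists_eq_add_of_le' hm
    simp only [wordPow_succ, Set.mem_ofPred_eq, List.pairwise_append, List.mem_append]
    grind

end IsAperiodic

/-! ### Marking one position of a word -/

/-- `Marked f₀ f₁ w z`: the word `z` arises from `w` by applying `f₁` to the letter at one position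
and `f₀` to all other letters. -/
inductive Marked {A B : Type*} (f₀ f₁ : A → B) : List A → List B → Prop
  | here (a : A) (v : List A) : Marked f₀ f₁ (a :: v) (f₁ a :: v.map f₀)
  | there (a : A) {v : List A} {z : List B} (h : Marked f₀ f₁ v z) :
      Marked f₀ f₁ (a :: v) (f₀ a :: z)

namespace Marked

variable {A B : Type*} {f₀ f₁ : A → B}

theorem nil_iff {z : List B} : Marked f₀ f₁ [] z ↔ False :=
  ⟨fun h => (by cases h), False.elim⟩

theorem cons_iff {a : A} {v : List A} {z : List B} :
    Marked f₀ f₁ (a :: v) z ↔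
      z = f₁ a :: v.map f₀ ∨ ∃ z', Marked f₀ f₁ v z' ∧ z = f₀ a :: z' := by
  constructor
  · intro h
    cases h with
    | here => exact Or.inl rfl
    | there _ h => exact Or.inr ⟨_, h, rfl⟩
  · rintro (rfl | ⟨z', h, rfl⟩)
    · exact .here a v
    · exact .there a h

theorem append_iff {x y : List A} {z : List B} :
    Marked f₀ f₁ (x ++ y) z ↔ (∃ p, Marked f₀ f₁ x p ∧ z = p ++ y.map f₀) ∨
      ∃ p, Marked f₀ f₁ y p ∧ z = x.map f₀ ++ p := by
  induction x generalizing z with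
  | nil => simp [nil_iff]
  | cons a x ih =>
    simp only [List.cons_append, cons_iff, ih, List.map_append, List.map_cons]
    constructor
    · rintro (rfl | ⟨z', (⟨p, hp, rfl⟩ | ⟨p, hp, rfl⟩), rfl⟩)
      · exact Or.inl ⟨_, Or.inl rfl, rfl⟩
      · exact Or.inl ⟨_, Or.inr ⟨p, hp, rfl⟩, rfl⟩
      · exact Or.inr ⟨p, hp, rfl⟩
    · rintro (⟨p, (rfl | ⟨z', hz, rfl⟩), rfl⟩ | ⟨p, hp, rfl⟩)
      · exact Or.inl rfl
      · exact Or.inr ⟨_, Or.inl ⟨z', hz, rfl⟩, rfl⟩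
      · exact Or.inr ⟨_, Or.inr ⟨p, hp, rfl⟩, rfl⟩

theorem wordPow_iff {u : List A} {m : ℕ} {z : List B} :
    Marked f₀ f₁ (wordPow u m) z ↔ ∃ i j p, i + j + 1 = m ∧ Marked f₀ f₁ u p ∧
      z = wordPow (u.map f₀) i ++ p ++ wordPow (u.map f₀) j := by
  induction m generalizing z with
  | zero => simp [wordPow_zero, nil_iff]
  | succ m ih =>
    simp only [wordPow_succ, append_iff, ih]
    constructor
    · rintro (⟨p, hp, rfl⟩ | ⟨_, ⟨i, j, p, rfl, hp, rfl⟩, rfl⟩)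
      · exact ⟨0, m, p, by omega, hp, by simp [wordPow_zero, map_wordPow]⟩
      · exact ⟨i + 1, j, p, by omega, hp, by simp [wordPow_succ]⟩
    · rintro ⟨i, j, p, h, hp, rfl⟩
      rcases i with _ | i
      · obtain rfl : j = m := by omega
        exact Or.inl ⟨p, hp, by simp [wordPow_zero, map_wordPow]⟩
      · exact Or.inr ⟨_, ⟨i, j, p, by omega, hp, rfl⟩, by simp [wordPow_succ]⟩

theorem ofFn_iff {n : ℕ} {g : Fin n → A} {z : List B} :
    Marked f₀ f₁ (List.ofFn g) z ↔
      ∃ i, z = List.ofFn fun k => if k = i then f₁ (g k) else f₀ (g k) := by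
  induction n generalizing z with
  | zero => simp [nil_iff]
  | succ n ih =>
    simp only [List.ofFn_succ, cons_iff, ih, Fin.exists_fin_succ, Fin.succ_inj,
      (Fin.succ_ne_zero _).symm, Fin.succ_ne_zero, if_true, if_false, List.map_ofFn]
    refine or_congr Iff.rfl ⟨?_, ?_⟩
    · rintro ⟨_, ⟨i, rfl⟩, rfl⟩
      exact ⟨i, rfl⟩
    · rintro ⟨i, rfl⟩
      exact ⟨_, ⟨i, rfl⟩, rfl⟩

end Marked

/-- Aperiodicity survives existential quantification over a marked position. In a word `x uᵐ y`
with the mark inside the power, one of the two unmarked powers of `u` around the mark is still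
large. -/
theorem IsAperiodic.exists_marked {A B : Type*} (f₀ f₁ : A → B) {L : Set (List B)}
    (h : IsAperiodic L) : IsAperiodic {w : List A | ∃ z, Marked f₀ f₁ w z ∧ z ∈ L} where
  finite_quot := by
    let F : Set (Set (List B)) → Set (List B) → Set (List A) := fun 𝒮 K =>
      {y | (∃ K' ∈ 𝒮, y.map f₀ ∈ K') ∨ ∃ p, Marked f₀ f₁ y p ∧ p ∈ K}
    refine (h.finite_quot.powerset.image2 F h.finite_quot).subset ?_
    rintro _ ⟨x, rfl⟩
    refine ⟨{K | ∃ p, Marked f₀ f₁ x p ∧ K = leftQuot L p}, ?_, _, ⟨x.map f₀, rfl⟩, ?_⟩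
    · rintro _ ⟨p, -, rfl⟩
      exact ⟨p, rfl⟩
    · ext y
      simp only [F, leftQuot, Set.mem_ofPred_eq, Marked.append_iff]
      constructor
      · rintro (⟨_, ⟨p, hp, rfl⟩, hy⟩ | ⟨p, hp, hy⟩)
        · exact ⟨_, Or.inl ⟨p, hp, rfl⟩, hy⟩
        · exact ⟨_, Or.inr ⟨p, hp, rfl⟩, hy⟩
      · rintro ⟨_, (⟨p, hp, rfl⟩ | ⟨p, hp, rfl⟩), hy⟩
        · exact Or.inl ⟨_, ⟨p, hp, rfl⟩, hy⟩
        · exact Or.inr ⟨p, hp, hy⟩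
  exists_pow := by
    obtain ⟨n, hn⟩ := h.exists_pow
    refine ⟨2 * n + 1, fun m hm x u y => ?_⟩
    have key : ∀ k, n ≤ k → ∀ p q, p ++ (wordPow (u.map f₀) k ++ q) ∈ L ↔
        p ++ (wordPow (u.map f₀) (k + 1) ++ q) ∈ L := fun k hk p q => by
      simpa using hn k hk p (u.map f₀) q
    simp only [Set.mem_ofPred_eq, Marked.append_iff, Marked.wordPow_iff, map_wordPow,
      List.map_append]
    constructor
    · rintro ⟨z, (⟨_, (⟨p, hp, rfl⟩ | ⟨_, ⟨i, j, p, hij, hp, rfl⟩, rfl⟩), rfl⟩ | ⟨p, hp, rfl⟩), hz⟩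
      · exact ⟨_, Or.inl ⟨_, Or.inl ⟨p, hp, rfl⟩, rfl⟩, (hn m (by omega) _ _ _).1 hz⟩
      · by_cases hi : n ≤ i
        · refine ⟨_, Or.inl ⟨_, Or.inr ⟨_, ⟨i + 1, j, p, by omega, hp, rfl⟩, rfl⟩, rfl⟩, ?_⟩
          simp only [List.append_assoc] at hz ⊢
          exact (key i hi _ _).1 hz
        · refine ⟨_, Or.inl ⟨_, Or.inr ⟨_, ⟨i, j + 1, p, by omega, hp, rfl⟩, rfl⟩, rfl⟩, ?_⟩
          have := (hn j (by omega) (x.map f₀ ++ (wordPow (u.map f₀) i ++ p)) (u.map f₀)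
            (y.map f₀)).1 (by simpa using hz)
          simpa using this
      · refine ⟨_, Or.inr ⟨p, hp, rfl⟩, (hn m (by omega) _ _ _).1 hz⟩
    · rintro ⟨z, (⟨_, (⟨p, hp, rfl⟩ | ⟨_, ⟨i, j, p, hij, hp, rfl⟩, rfl⟩), rfl⟩ | ⟨p, hp, rfl⟩), hz⟩
      · exact ⟨_, Or.inl ⟨_, Or.inl ⟨p, hp, rfl⟩, rfl⟩, (hn m (by omega) _ _ _).2 hz⟩
      · by_cases hi : n + 1 ≤ i
        · obtain ⟨i, rfl⟩ := Nat.exists_eq_add_of_le' (le_trans (Nat.le_add_left 1 n) hi)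
          refine ⟨_, Or.inl ⟨_, Or.inr ⟨_, ⟨i, j, p, by omega, hp, rfl⟩, rfl⟩, rfl⟩, ?_⟩
          simp only [List.append_assoc] at hz ⊢
          exact (key i (by omega) _ _).2 hz
        · obtain ⟨j, rfl⟩ := Nat.exists_eq_add_of_le' (show 1 ≤ j by omega)
          refine ⟨_, Or.inl ⟨_, Or.inr ⟨_, ⟨i, j, p, by omega, hp, rfl⟩, rfl⟩, rfl⟩, ?_⟩
          have := (hn j (by omega) (x.map f₀ ++ (wordPow (u.map f₀) i ++ p)) (u.map f₀)
            (y.map f₀)).2 (by simpa using hz)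
          simpa using this
      · refine ⟨_, Or.inr ⟨p, hp, rfl⟩, (hn m (by omega) _ _ _).2 hz⟩

/-! ### First-order definable languages are aperiodic -/

attribute [local instance] wordStructure

open FirstOrder

/-- The word `w` together with a valuation of `n` variables, coded as a word over the alphabet
`A × 2ⁿ`: each position carries the set of variables whose value it is. -/
def valuedWord {A : Type u} {n : ℕ} (w : List A) (xs : Fin n → Fin w.length) :
    List (A × (Fin n → Prop)) :=
  List.ofFn fun k => (w.get k, fun j => xs j = k)

theorem marked_valuedWord_iff {A : Type u} {n : ℕ} {w : List A} {xs : Fin n → Fin w.length}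
    {z : List (A × (Fin (n + 1) → Prop))} :
    Marked (fun p : A × (Fin n → Prop) => (p.1, (Fin.snoc p.2 False : Fin (n + 1) → Prop)))
      (fun p => (p.1, (Fin.snoc p.2 True : Fin (n + 1) → Prop))) (valuedWord w xs) z ↔
      ∃ i, z = valuedWord w (Fin.snoc xs i) := by
  rw [valuedWord, Marked.ofFn_iff]
  refine exists_congr fun i => ?_
  suffices h : (List.ofFn fun k : Fin w.length => if k = i then
      (w.get k, (Fin.snoc (fun j => xs j = k) True : Fin (n + 1) → Prop)) else
      (w.get k, (Fin.snoc (fun j => xs j = k) False : Fin (n + 1) → Prop))) =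
      valuedWord w (Fin.snoc xs i) by rw [← h]
  unfold valuedWord
  congr 1
  funext k
  have h : ∀ P : Prop, P = (i = k) →
      (Fin.snoc (fun j => xs j = k) P : Fin (n + 1) → Prop) =
        fun j => (Fin.snoc xs i : Fin (n + 1) → Fin w.length) j = k := by
    rintro _ rfl
    funext j
    refine Fin.lastCases ?_ (fun j => ?_) j <;> simp
  split_ifs with hk
  · rw [h _ (by simp [hk])]
  · rw [h _ (by simp [Ne.symm hk])]

theorem exists_eq_var {A : Type u} {n : ℕ} (t : (wordSignature A).Term (Empty ⊕ Fin n)) :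
    ∃ i, t = Language.Term.var (Sum.inr i) := by
  cases t with
  | var x =>
    cases x with
    | inl x => exact x.elim
    | inr i => exact ⟨i, rfl⟩
  | func f ts => exact Empty.elim f

theorem exists_isAperiodic_of_boundedFormula {A : Type u} {n : ℕ}
    (φ : (wordSignature A).BoundedFormula Empty n) :
    ∃ L : Set (List (A × (Fin n → Prop))), IsAperiodic L ∧
      ∀ (w : List A) (xs : Fin n → Fin w.length),
        valuedWord w xs ∈ L ↔ φ.Realize (fun x => x.elim) xs := by
  induction φ with
  | falsum => exact ⟨∅, .empty, fun w xs => Iff.rfl⟩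
  | equal t₁ t₂ =>
    obtain ⟨i, rfl⟩ := exists_eq_var t₁
    obtain ⟨j, rfl⟩ := exists_eq_var t₂
    refine ⟨_, .exists_mem fun p => p.2 i ∧ p.2 j, fun w xs => ?_⟩
    simp [valuedWord, List.mem_ofFn, Language.BoundedFormula.Realize]
  | rel R ts =>
    choose is his using fun k => exists_eq_var (ts k)
    cases R with
    | lt =>
      refine ⟨_, (IsAperiodic.pairwise (fun p => p.2 (is 0)) (fun p => p.2 (is 1))).compl,
        fun w xs => ?_⟩
      simp [valuedWord, Language.BoundedFormula.Realize, List.pairwise_ofFn, his,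
        Language.Structure.RelMap, WordRel.Holds]
    | letter a =>
      refine ⟨_, .exists_mem fun p => p.1 = a ∧ p.2 (is 0), fun w xs => ?_⟩
      simp [valuedWord, List.mem_ofFn, Language.BoundedFormula.Realize, his,
        Language.Structure.RelMap, WordRel.Holds]
  | imp φ ψ ih₁ ih₂ =>
    obtain ⟨L, hL, h⟩ := ih₁
    obtain ⟨K, hK, h'⟩ := ih₂
    refine ⟨(L ∩ Kᶜ)ᶜ, (hL.inter hK.compl).compl, fun w xs => ?_⟩
    simp [h, h']
  | all φ ih =>
    obtain ⟨L, hL, h⟩ := ih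
    refine ⟨_, (hL.compl.exists_marked
      (fun p => (p.1, Fin.snoc p.2 False)) (fun p => (p.1, Fin.snoc p.2 True))).compl,
      fun w xs => ?_⟩
    simp only [Set.mem_compl_iff, Set.mem_ofPred_eq, marked_valuedWord_iff,
      Language.BoundedFormula.realize_all, ← h]
    grind

theorem isAperiodic_setOf_wordModels {A : Type u} (φ : (wordSignature A).Sentence) :
    IsAperiodic {w : List A | WordModels w φ} := by
  obtain ⟨L, hL, h⟩ := exists_isAperiodic_of_boundedFormula φ
  convert hL.preimage_map (fun a => (a, default)) using 1
  ext w
  have hw : w.map (fun a => (a, (default : Fin 0 → Prop))) = valuedWord w default := by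
    conv_lhs => rw [← List.ofFn_get w, List.map_ofFn]
    unfold valuedWord
    congr 1
    funext k
    exact Prod.ext rfl (Subsingleton.elim _ _)
  simp only [Set.mem_ofPred_eq, hw, h]
  unfold WordModels Language.Sentence.Realize Language.Formula.Realize
  rw [Subsingleton.elim (default : Empty → Fin w.length) (fun x => x.elim)]

/-! ### Languages defined by future formulas -/

/-- Non-strict "`K` until `L`" on the suffixes of a word, the empty suffix included: some suffix
belongs to `L`, and all longer suffixes belong to `K`. -/
def HoldsUntil {A : Type*} (L K : Set (List A)) : List A → Prop
  | [] => [] ∈ L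
  | a :: v => a :: v ∈ L ∨ (a :: v ∈ K ∧ HoldsUntil L K v)

/-- The languages of possibly empty words defined by temporal formulas with the operators "next"
and non-strict "until". Formulas are evaluated at suffixes; the empty suffix is a legitimate point
of evaluation, so that "next" can be applied at the last letter. -/
inductive FutureDefinable {A : Type u} : Set (List A) → Prop
  | univ : FutureDefinable Set.univ
  | letter (a : A) : FutureDefinable {w | w.head? = some a}
  | compl {L : Set (List A)} (h : FutureDefinable L) : FutureDefinable Lᶜ
  | inter {L K : Set (List A)} (h : FutureDefinable L) (h' : FutureDefinable K) :
      FutureDefinable (L ∩ K)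
  | next {L : Set (List A)} (h : FutureDefinable L) :
      FutureDefinable {w | ∃ a v, w = a :: v ∧ v ∈ L}
  | untl {L K : Set (List A)} (h : FutureDefinable L) (h' : FutureDefinable K) :
      FutureDefinable {w | HoldsUntil L K w}

/-- The words `v c z` with `z ∈ L`, where the displayed `c` is the first one. -/
def afterFirst {A : Type*} (c : A) (L : Set (List A)) : Set (List A) :=
  {w | ∃ v z, w = v ++ c :: z ∧ c ∉ v ∧ z ∈ L}

/-- The words `v c z` with `v ∈ L`, where the displayed `c` is the first one. -/
def beforeFirst {A : Type*} (c : A) (L : Set (List A)) : Set (List A) :=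
  {w | ∃ v z, w = v ++ c :: z ∧ c ∉ v ∧ v ∈ L}

section FirstOccurrence

variable {A : Type*} {c : A} {L : Set (List A)}

theorem nil_notMem_afterFirst : [] ∉ afterFirst c L := by
  rintro ⟨v, z, h, -⟩
  simp at h

theorem cons_mem_afterFirst {a : A} {v : List A} :
    a :: v ∈ afterFirst c L ↔ (a = c ∧ v ∈ L) ∨ (a ≠ c ∧ v ∈ afterFirst c L) := by
  constructor
  · rintro ⟨_ | ⟨b, x⟩, z, h, hc, hz⟩
    · simp only [List.nil_append, List.cons.injEq] at h
      exact Or.inl ⟨h.1, h.2 ▸ hz⟩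
    · simp only [List.cons_append, List.cons.injEq] at h
      simp only [List.mem_cons, not_or] at hc
      exact Or.inr ⟨h.1 ▸ Ne.symm hc.1, x, z, h.2, hc.2, hz⟩
  · rintro (⟨rfl, hz⟩ | ⟨hne, x, z, rfl, hc, hz⟩)
    · exact ⟨[], v, rfl, by simp, hz⟩
    · exact ⟨a :: x, z, rfl, by simp [hc, Ne.symm hne], hz⟩

theorem nil_notMem_beforeFirst : [] ∉ beforeFirst c L := by
  rintro ⟨v, z, h, -⟩
  simp at h

theorem cons_mem_beforeFirst {a : A} {v : List A} :
    a :: v ∈ beforeFirst c L ↔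
      (a = c ∧ [] ∈ L) ∨ (a ≠ c ∧ v ∈ beforeFirst c {x | a :: x ∈ L}) := by
  constructor
  · rintro ⟨_ | ⟨b, x⟩, z, h, hc, hz⟩
    · simp only [List.nil_append, List.cons.injEq] at h
      exact Or.inl ⟨h.1, hz⟩
    · simp only [List.cons_append, List.cons.injEq] at h
      simp only [List.mem_cons, not_or] at hc
      exact Or.inr ⟨h.1 ▸ Ne.symm hc.1, x, z, h.2, hc.2, h.1 ▸ hz⟩
  · rintro (⟨rfl, hz⟩ | ⟨hne, x, z, rfl, hc, hz⟩)
    · exact ⟨[], v, rfl, by simp, hz⟩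
    · exact ⟨a :: x, z, rfl, by simp [hc, Ne.symm hne], hz⟩

theorem append_mem_beforeFirst {v z : List A} (hc : c ∉ v) :
    v ++ c :: z ∈ beforeFirst c L ↔ v ∈ L := by
  induction v generalizing L with
  | nil => simp [cons_mem_beforeFirst]
  | cons a v ih =>
    simp only [List.mem_cons, not_or] at hc
    simp [cons_mem_beforeFirst, Ne.symm hc.1, ih hc.2]

theorem append_mem_afterFirst {v z : List A} (hc : c ∉ v) :
    v ++ c :: z ∈ afterFirst c L ↔ z ∈ L := by
  induction v with
  | nil => simp [cons_mem_afterFirst]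
  | cons a v ih =>
    simp only [List.mem_cons, not_or] at hc
    simp [cons_mem_afterFirst, Ne.symm hc.1, ih hc.2]

theorem mem_beforeFirst_univ {w : List A} : w ∈ beforeFirst c Set.univ ↔ c ∈ w := by
  induction w with
  | nil => simp [nil_notMem_beforeFirst]
  | cons a v ih =>
    simp only [Set.mem_univ, Set.ofPred_true, cons_mem_beforeFirst, and_true, ih, List.mem_cons]
    grind

end FirstOccurrence

namespace FutureDefinable

variable {A : Type u}

theorem empty : FutureDefinable (∅ : Set (List A)) := by
  simpa using univ.compl (A := A)

theorem union {L K : Set (List A)} (h : FutureDefinable L) (h' : FutureDefinable K) :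
    FutureDefinable (L ∪ K) := by
  simpa [Set.compl_inter] using (h.compl.inter h'.compl).compl

theorem iUnion {ι : Type*} [Finite ι] {L : ι → Set (List A)} (h : ∀ i, FutureDefinable (L i)) :
    FutureDefinable (⋃ i, L i) := by
  have : ∀ s : Set ι, s.Finite → FutureDefinable (⋃ i ∈ s, L i) := fun s hs => by
    induction s, hs using Set.Finite.induction_on with
    | empty => simpa using empty
    | insert _ _ ih => simpa using (h _).union ih
  simpa using this Set.univ Set.finite_univ

theorem sep (p : Prop) {L : Set (List A)} (h : FutureDefinable L) :
    FutureDefinable {w | p ∧ w ∈ L} := by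
  by_cases hp : p
  · simpa [hp] using h
  · simpa [hp] using empty

/-- "The first letter is `c`, and the rest belongs to `L`." -/
theorem cons (c : A) {L : Set (List A)} (h : FutureDefinable L) :
    FutureDefinable {w | ∃ v, w = c :: v ∧ v ∈ L} := by
  convert (letter c).inter h.next using 1
  ext w
  cases w <;> simp [eq_comm]

theorem forall_mem [Finite A] (S : Set A) : FutureDefinable {w : List A | ∀ a ∈ w, a ∈ S} := by
  have h : FutureDefinable (⋃ a : A, {w | a ∉ S ∧ w ∈ {w : List A | w.head? = some a}}) :=
    iUnion fun a => (letter a).sep _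
  convert (untl h univ).compl using 1
  ext w
  simp only [Set.mem_ofPred_eq, Set.mem_compl_iff]
  induction w with
  | nil => simp [HoldsUntil]
  | cons a v ih =>
    simp only [List.mem_cons, forall_eq_or_imp, ih]
    simp [HoldsUntil]

theorem afterFirst (c : A) {L : Set (List A)} (h : FutureDefinable L) :
    FutureDefinable (afterFirst c L) := by
  convert untl (h.cons c) (letter c).compl using 1
  ext w
  simp only [Set.mem_ofPred_eq]
  induction w with
  | nil => simp [HoldsUntil, nil_notMem_afterFirst]
  | cons a v ih => simp [HoldsUntil, cons_mem_afterFirst, ih]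

/-- Relativization of a formula to the prefix before the first `c`. -/
theorem beforeFirst (c : A) {L : Set (List A)} (h : FutureDefinable L) :
    FutureDefinable (beforeFirst c L) := by
  have huniv : FutureDefinable (_root_.beforeFirst c (Set.univ : Set (List A))) := by
    convert untl (letter c) (univ (A := A)) using 1
    ext w
    rw [mem_beforeFirst_univ, Set.mem_ofPred_eq]
    induction w with
    | nil => simp [HoldsUntil]
    | cons a v ih => simp [HoldsUntil, ih, eq_comm]
  -- A word without `c` lies in no relativized language; otherwise it can be split at the first `c`.
  have key : ∀ {L K : Set (List A)}, (∀ w, c ∉ w → w ∉ K) →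
      (∀ v z, c ∉ v → (v ++ c :: z ∈ K ↔ v ∈ L)) → _root_.beforeFirst c L = K := by
    intro L K h₁ h₂
    ext w
    by_cases hw : c ∈ w
    · obtain ⟨v, z, rfl, hv⟩ := List.eq_append_cons_of_mem hw
      rw [append_mem_beforeFirst hv, h₂ v z hv]
    · refine iff_of_false ?_ (h₁ w hw)
      rintro ⟨v, z, rfl, -⟩
      simp at hw
  induction h with
  | univ => exact huniv
  | letter a =>
    by_cases ha : a = c
    · convert empty using 1
      refine key (by simp) fun v z hv => ?_
      subst ha
      cases v <;> simp at hv ⊢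
      exact Ne.symm hv.1
    · convert (letter a).inter huniv using 1
      refine key (fun w hw => by simp [mem_beforeFirst_univ, hw]) fun v z hv => ?_
      cases v <;> simp [mem_beforeFirst_univ, Ne.symm ha]
  | @compl L h ih =>
    convert ih.compl.inter huniv using 1
    refine key (fun w hw => by simp [mem_beforeFirst_univ, hw]) fun v z hv => ?_
    simp [append_mem_beforeFirst hv]
  | @inter L K h h' ih ih' =>
    convert ih.inter ih' using 1
    refine key (fun w hw => ?_) fun v z hv => ?_
    · rintro ⟨⟨v, z, rfl, -⟩, -⟩
      simp at hw
    · simp [append_mem_beforeFirst hv]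
  | @next L h ih =>
    convert ih.next.inter (letter c).compl using 1
    refine key (fun w hw => ?_) fun v z hv => ?_
    · rintro ⟨⟨a, _, rfl, v, z, rfl, -⟩, -⟩
      simp at hw
    · cases v with
      | nil => simp
      | cons a v =>
        simp only [List.mem_cons, not_or] at hv
        simp [append_mem_beforeFirst hv.2, Ne.symm hv.1]
  | @untl L K h h' ih ih' =>
    -- The search must not run past the first `c`.
    convert untl ih (ih'.inter (letter c).compl) using 1
    refine key (fun w hw => ?_) fun v z hv => ?_
    · induction w with
      | nil => exact nil_notMem_beforeFirst
      | cons a w ihw =>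
        rintro (⟨v, z, h, -⟩ | ⟨-, h⟩)
        · simp [h] at hw
        · exact ihw (fun h => hw (List.mem_cons_of_mem _ h)) h
    · simp only [Set.mem_ofPred_eq]
      induction v with
      | nil => simp [HoldsUntil, cons_mem_beforeFirst]
      | cons a v ihv =>
        have h₁ := append_mem_beforeFirst (z := z) (L := L) hv
        have h₂ := append_mem_beforeFirst (z := z) (L := K) hv
        simp only [List.mem_cons, not_or] at hv
        simp only [List.cons_append] at h₁ h₂
        simp [HoldsUntil, h₁, h₂, ihv hv.2, Ne.symm hv.1]

end FutureDefinable

/-! ### Counter-free automata -/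

/-- The transformation of the states induced by a word. -/
def run {A Q : Type*} (δ : A → Q → Q) (w : List A) (q : Q) : Q := w.foldl (fun q a => δ a q) q

section Run

variable {A Q : Type*} (δ : A → Q → Q)

theorem run_nil : run δ [] = id := rfl

theorem run_cons (a : A) (v : List A) : run δ (a :: v) = run δ v ∘ δ a := rfl

theorem run_append (v w : List A) (q : Q) : run δ (v ++ w) q = run δ w (run δ v q) := by
  simp [run]

theorem run_wordPow (u : List A) (m : ℕ) : run δ (wordPow u m) = (run δ u)^[m] := by
  induction m with
  | zero => rfl
  | succ m ih =>
    funext q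
    rw [wordPow_succ, run_append, ih, Function.iterate_succ_apply]

end Run

/-- No word over the letters in `S` permutes a set of states nontrivially: the iterates of the
transformation induced by a word become constant, uniformly in the word. -/
def IsCounterFree {A Q : Type*} (δ : A → Q → Q) (S : Set A) : Prop :=
  ∃ n, ∀ u : List A, (∀ a ∈ u, a ∈ S) → (run δ u)^[n + 1] = (run δ u)^[n]

theorem IsCounterFree.mono {A Q : Type*} {δ : A → Q → Q} {S S' : Set A} (h : IsCounterFree δ S)
    (hS : S' ⊆ S) : IsCounterFree δ S' :=
  let ⟨n, hn⟩ := h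
  ⟨n, fun u hu => hn u fun a ha => hS (hu a ha)⟩

/-- In a finite counter-free automaton a surjective letter acts trivially. -/
theorem IsCounterFree.eq_id_of_surjective {A Q : Type*} {δ : A → Q → Q}
    {S : Set A} (h : IsCounterFree δ S) {c : A} (hc : c ∈ S) (hs : Function.Surjective (δ c)) :
    δ c = id := by
  obtain ⟨n, hn⟩ := h
  have h := hn [c] (by simpa using hc)
  have h' : run δ [c] = δ c := rfl
  rw [h'] at h
  funext q
  obtain ⟨p, rfl⟩ := hs.iterate n q
  simpa [Function.iterate_succ_apply'] using congrFun h p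

open Classical in
/-- Cut a word after each occurrence of `c`. These are the transformations induced by the pieces
without their final `c`; what follows the last `c` is discarded. -/
noncomputable def blockMaps {A Q : Type*} (δ : A → Q → Q) (c : A) : List A → List (Q → Q)
  | [] => []
  | a :: v => if a = c then id :: blockMaps δ c v else (blockMaps δ c v).modifyHead (· ∘ δ a)

open Classical in
/-- The transformation induced by the part of a word after the last `c`. -/
noncomputable def lastMap {A Q : Type*} (δ : A → Q → Q) (c : A) : List A → Q → Q
  | [] => id
  | a :: v => if a = c ∨ c ∈ v then lastMap δ c v else lastMap δ c v ∘ δ a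

section Blocks

variable {A Q : Type*} {δ : A → Q → Q} {c : A}

theorem blockMaps_eq_nil {v : List A} : blockMaps δ c v = [] ↔ c ∉ v := by
  induction v with
  | nil => simp [blockMaps]
  | cons a v ih =>
    by_cases h : a = c
    · simp [blockMaps, h]
    · simp [blockMaps, h, ih, Ne.symm h]

theorem blockMaps_append {v z : List A} (hv : c ∉ v) :
    blockMaps δ c (v ++ c :: z) = run δ v :: blockMaps δ c z := by
  induction v with
  | nil => simp [blockMaps, run_nil]
  | cons a v ih =>
    simp only [List.mem_cons, not_or] at hv
    simp [blockMaps, Ne.symm hv.1, ih hv.2, run_cons]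

theorem lastMap_eq_run {v : List A} (hv : c ∉ v) : lastMap δ c v = run δ v := by
  induction v with
  | nil => rfl
  | cons a v ih =>
    simp only [List.mem_cons, not_or] at hv
    simp [lastMap, Ne.symm hv.1, hv.2, ih hv.2, run_cons]

theorem run_eq_lastMap (v : List A) (q : Q) :
    run δ v q = lastMap δ c v (run (fun t q => δ c (t q)) (blockMaps δ c v) q) := by
  induction v generalizing q with
  | nil => rfl
  | cons a v ih =>
    rw [run_cons, Function.comp_apply, ih]
    by_cases h : a = c
    · subst h
      simp [lastMap, blockMaps, run_cons]
    · by_cases hv : c ∈ v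
      · have := mt (blockMaps_eq_nil (δ := δ)).1 (not_not.2 hv)
        obtain ⟨t, ts, hts⟩ := List.exists_cons_of_ne_nil this
        simp [lastMap, blockMaps, h, hv, hts, run_cons]
      · simp [lastMap, blockMaps, h, hv, blockMaps_eq_nil.2 hv, run_nil]

theorem exists_run_of_mem_blockMaps {S : Set A} {v : List A} (hv : ∀ a ∈ v, a ∈ S) {t : Q → Q}
    (ht : t ∈ blockMaps δ c v) : ∃ u, (∀ a ∈ u, a ∈ S \ {c}) ∧ run δ u = t := by
  induction v generalizing t with
  | nil => simp [blockMaps] at ht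
  | cons a v ih =>
    simp only [List.mem_cons, forall_eq_or_imp] at hv
    by_cases h : a = c
    · simp only [blockMaps, h, if_true, List.mem_cons] at ht
      rcases ht with rfl | ht
      · exact ⟨[], by simp, rfl⟩
      · exact ih hv.2 ht
    · simp only [blockMaps, h, if_false] at ht
      cases hts : blockMaps δ c v with
      | nil => simp [hts] at ht
      | cons s ts =>
        simp only [hts, List.modifyHead_cons, List.mem_cons] at ht ih
        rcases ht with rfl | ht
        · obtain ⟨u, hu, rfl⟩ := ih hv.2 (Or.inl rfl)
          refine ⟨a :: u, ?_, run_cons ..⟩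
          simp only [List.mem_cons, forall_eq_or_imp]
          exact ⟨⟨hv.1, h⟩, hu⟩
        · exact ih hv.2 (Or.inr ht)

end Blocks

theorem forall_mem_diff_iff {A : Type*} {S : Set A} {c : A} {v : List A} :
    (∀ a ∈ v, a ∈ S \ {c}) ↔ (∀ a ∈ v, a ∈ S) ∧ c ∉ v := by
  simp only [Set.mem_sdiff, Set.mem_singleton_iff]
  grind

section Step

variable {A Q : Type u} {δ : A → Q → Q} {c : A} {S : Set A}

/-- A formula about the sequence of blocks is a formula about the word: the letter "`t`" becomes
"the prefix before the next `c` induces `t`", and "next" becomes a jump behind the next `c`. -/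
theorem FutureDefinable.blockMaps_mem [Finite A]
    (hB : ∀ t, FutureDefinable {w : List A | (∀ a ∈ w, a ∈ S \ {c}) ∧ run δ w = t})
    {K : Set (List (Q → Q))} (hK : FutureDefinable K) :
    FutureDefinable {w : List A | (∀ a ∈ w, a ∈ S) ∧ blockMaps δ c w ∈ K} := by
  have hS := FutureDefinable.forall_mem S
  induction hK with
  | univ => simpa using hS
  | letter t =>
    convert hS.inter ((hB t).beforeFirst c) using 1
    ext w
    simp only [Set.mem_inter_iff, Set.mem_ofPred_eq]
    refine and_congr_right fun hw => ?_
    by_cases hc : c ∈ w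
    · obtain ⟨v, z, rfl, hv⟩ := List.eq_append_cons_of_mem hc
      have hvS : ∀ a ∈ v, a ∈ S \ {c} :=
        forall_mem_diff_iff.2 ⟨fun a ha => hw a (List.mem_append_left _ ha), hv⟩
      rw [append_mem_beforeFirst hv, blockMaps_append hv]
      simp only [List.head?_cons, Option.some.injEq, Set.mem_ofPred_eq]
      exact ⟨fun h => ⟨hvS, h⟩, fun h => h.2⟩
    · rw [blockMaps_eq_nil.2 hc]
      refine iff_of_false (by simp) ?_
      rintro ⟨v, z, rfl, -⟩
      simp at hc
  | @compl K _ ih =>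
    convert hS.inter ih.compl using 1
    ext w
    simp only [Set.mem_inter_iff, Set.mem_compl_iff, Set.mem_ofPred_eq]
    tauto
  | @inter K K' _ _ ih ih' =>
    convert ih.inter ih' using 1
    ext w
    simp only [Set.mem_inter_iff, Set.mem_ofPred_eq]
    tauto
  | @next K _ ih =>
    convert hS.inter (ih.afterFirst c) using 1
    ext w
    simp only [Set.mem_inter_iff, Set.mem_ofPred_eq]
    refine and_congr_right fun hw => ?_
    by_cases hc : c ∈ w
    · obtain ⟨v, z, rfl, hv⟩ := List.eq_append_cons_of_mem hc
      rw [append_mem_afterFirst hv, blockMaps_append hv]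
      have hz : ∀ a ∈ z, a ∈ S := fun a ha => hw a (by simp [ha])
      simp only [Set.mem_ofPred_eq]
      constructor
      · rintro ⟨_, _, h, h'⟩
        cases h
        exact ⟨hz, h'⟩
      · rintro ⟨-, h⟩
        exact ⟨_, _, rfl, h⟩
    · rw [blockMaps_eq_nil.2 hc]
      refine iff_of_false (by simp) ?_
      rintro ⟨v, z, rfl, -⟩
      simp at hc
  | @untl K K' _ _ ih ih' =>
    -- Beyond the current position, only the positions behind some `c` count.
    have key : ∀ w : List A, (∀ a ∈ w, a ∈ S) →
        (HoldsUntil {w | ∃ v, w = c :: v ∧ v ∈ {w | (∀ a ∈ w, a ∈ S) ∧ blockMaps δ c w ∈ K}}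
          ({w | w.head? = some c}ᶜ ∪ {w | ∃ a v, w = a :: v ∧ v ∈ {w | (∀ a ∈ w, a ∈ S) ∧
            blockMaps δ c w ∈ K'}}) w ↔
          ∃ t ts, blockMaps δ c w = t :: ts ∧ HoldsUntil K K' ts) := by
      intro w hw
      induction w with
      | nil => simp [HoldsUntil, blockMaps]
      | cons a v ihv =>
        simp only [List.mem_cons, forall_eq_or_imp] at hw
        specialize ihv hw.2
        by_cases h : a = c
        · subst h
          simp only [HoldsUntil, ihv]
          cases hts : blockMaps δ a v with
          | nil => simp [blockMaps, hts, HoldsUntil]; tauto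
          | cons t ts => simp [blockMaps, hts, HoldsUntil]; tauto
        · simp only [HoldsUntil, ihv]
          cases hts : blockMaps δ c v with
          | nil => simp [blockMaps, hts, h]
          | cons t ts => simp [blockMaps, hts, h]
    convert hS.inter (ih.union (ih'.inter
      (untl (ih.cons c) ((letter c).compl.union ih'.next)))) using 1
    ext w
    simp only [Set.mem_inter_iff, Set.mem_union, Set.mem_ofPred_eq]
    refine and_congr_right fun hw => ?_
    have := key w hw
    simp only [Set.mem_ofPred_eq] at this
    rw [this]
    cases hts : blockMaps δ c w with
    | nil => simp [HoldsUntil]; tauto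
    | cons t ts => simp [HoldsUntil]; tauto

theorem FutureDefinable.lastMap_eq [Finite A]
    (hB : ∀ t, FutureDefinable {w : List A | (∀ a ∈ w, a ∈ S \ {c}) ∧ run δ w = t}) (t : Q → Q) :
    FutureDefinable {w : List A | (∀ a ∈ w, a ∈ S) ∧ lastMap δ c w = t} := by
  convert (FutureDefinable.forall_mem S).inter
    ((hB t).union (untl ((hB t).cons c) univ)) using 1
  ext w
  simp only [Set.mem_inter_iff, Set.mem_union, Set.mem_ofPred_eq]
  refine and_congr_right fun hw => ?_
  simp only [forall_mem_diff_iff]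
  induction w with
  | nil => simp [HoldsUntil, lastMap, run_nil]
  | cons a v ih =>
    simp only [List.mem_cons, forall_eq_or_imp] at hw
    specialize ih hw.2
    have hu : HoldsUntil {w | ∃ v, w = c :: v ∧ ((∀ a ∈ v, a ∈ S) ∧ c ∉ v) ∧ run δ v = t}
        Set.univ v → c ∈ v := by
      clear ih hw
      intro h
      induction v with
      | nil => simp [HoldsUntil] at h
      | cons b v ih =>
        simp only [HoldsUntil] at h
        rcases h with ⟨_, h, -⟩ | ⟨-, h⟩
        · simp [(List.cons.inj h).1]
        · exact List.mem_cons_of_mem _ (ih h)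
    by_cases hc : c ∈ v
    · simp [lastMap, ih, HoldsUntil, hc]
    · simp only [hc, imp_false] at hu
      simp only [HoldsUntil, hu, and_false, or_false, List.mem_cons, hc, Set.mem_ofPred_eq]
      by_cases h : a = c
      · subst h
        simp [lastMap, lastMap_eq_run hc, hc]; tauto
      · simp [lastMap, lastMap_eq_run hc, hc, h, Ne.symm h, hw.1, run_cons]; tauto

/-- Passing from the states `Q` to the image of `c`, with the transformations induced by the words
without `c` as new letters, preserves counter-freeness: every word of new letters acts as a word
of old letters. -/
theorem IsCounterFree.range (h : IsCounterFree δ S) (hc : c ∈ S) :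
    IsCounterFree (fun (t : Q → Q) (q : Set.range (δ c)) =>
        (⟨δ c (t q), Set.mem_range_self _⟩ : Set.range (δ c)))
      {t | ∃ u, (∀ a ∈ u, a ∈ S \ {c}) ∧ run δ u = t} := by
  obtain ⟨n, hn⟩ := h
  refine ⟨n, fun ts hts => ?_⟩
  have key : ∃ u, (∀ a ∈ u, a ∈ S) ∧ ∀ q : Set.range (δ c),
      ((run (fun (t : Q → Q) (q : Set.range (δ c)) =>
        (⟨δ c (t q), Set.mem_range_self _⟩ : Set.range (δ c))) ts q : Set.range (δ c)) : Q) =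
        run δ u q := by
    induction ts with
    | nil => exact ⟨[], by simp, fun q => rfl⟩
    | cons t ts ih =>
      simp only [List.mem_cons, forall_eq_or_imp] at hts
      obtain ⟨u, hu, h⟩ := ih hts.2
      obtain ⟨v, hv, rfl⟩ := hts.1
      refine ⟨v ++ c :: u, ?_, fun q => ?_⟩
      · simp only [List.mem_append, List.mem_cons]
        rintro a (ha | rfl | ha)
        · exact (hv a ha).1
        · exact hc
        · exact hu a ha
      · rw [run_cons, Function.comp_apply, h, run_append, run_cons]
        rfl
  obtain ⟨u, hu, h⟩ := key
  have hs : Function.Semiconj (Subtype.val : Set.range (δ c) → Q) _ (run δ u) := h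
  funext q
  apply Subtype.ext
  rw [(hs.iterate_right (n + 1)).eq, (hs.iterate_right n).eq, hn u hu]

end Step

/-- The induction is on the number of states, then on the number of letters. If all letters act
trivially, there is nothing to do. Otherwise some letter `c` acts non-surjectively. A word
`v₀ c v₁ c ⋯ c vₖ` is split into `v₀`, treated by induction on the letters, the sequence of blocks
between the first and the last `c`, whose transformations form a word acting on the smaller
state set `Q c`, and `vₖ`. -/
theorem FutureDefinable.run_eq {A Q : Type u} [Finite A] [Finite Q] (δ : A → Q → Q) (S : Set A)
    (h : IsCounterFree δ S) (f : Q → Q) :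
    FutureDefinable {w : List A | (∀ a ∈ w, a ∈ S) ∧ run δ w = f} := by
  induction hn : Nat.card Q using Nat.strong_induction_on generalizing A Q with
  | _ n ihQ =>
  subst hn
  induction hm : S.ncard using Nat.strong_induction_on generalizing S f with
  | _ m ihS =>
  subst hm
  by_cases hid : ∀ a ∈ S, δ a = id
  · have hrun : ∀ w : List A, (∀ a ∈ w, a ∈ S) → run δ w = id := fun w hw => by
      induction w with
      | nil => rfl
      | cons a v ih =>
        simp only [List.mem_cons, forall_eq_or_imp] at hw
        rw [run_cons, ih hw.2, hid a hw.1]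
        rfl
    convert (forall_mem S).sep (id = f) using 1
    ext w
    simp only [Set.mem_ofPred_eq]
    rw [and_comm]
    exact and_congr_left fun hw => by rw [hrun w hw]
  push Not at hid
  obtain ⟨c, hc, hne⟩ := hid
  have hB : ∀ t, FutureDefinable {w : List A | (∀ a ∈ w, a ∈ S \ {c}) ∧ run δ w = t} := fun t =>
    ihS _ (Set.ncard_sdiff_singleton_lt_of_mem hc) (S \ {c}) (h.mono Set.sdiff_subset) t rfl
  have hcard : Nat.card (Set.range (δ c)) < Nat.card Q := by
    obtain ⟨x, hx⟩ : ∃ x, x ∉ Set.range (δ c) := by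
      by_contra! hs
      exact hne (h.eq_id_of_surjective hc hs)
    exact Finite.card_subtype_lt hx
  let δ' : (Q → Q) → Set.range (δ c) → Set.range (δ c) := fun t q => ⟨δ c (t q), Set.mem_range_self _⟩
  let S' : Set (Q → Q) := {t | ∃ u, (∀ a ∈ u, a ∈ S \ {c}) ∧ run δ u = t}
  have hT : ∀ k, FutureDefinable {ts : List (Q → Q) | (∀ t ∈ ts, t ∈ S') ∧ run δ' ts = k} :=
    fun k => ihQ _ hcard δ' S' (h.range hc) k rfl
  have hval : ∀ (ts : List (Q → Q)) (q : Set.range (δ c)),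
      ((run δ' ts q : Set.range (δ c)) : Q) = run (fun t q => δ c (t q)) ts q := fun ts => by
    induction ts with
    | nil => exact fun q => rfl
    | cons t ts ih => exact fun q => ih _
  convert (hB f).union (iUnion fun i : (Q → Q) × (Set.range (δ c) → Set.range (δ c)) × (Q → Q) =>
    (((forall_mem S).inter (((hB i.1).beforeFirst c).inter
      (((blockMaps_mem hB (hT i.2.1)).inter (lastMap_eq hB i.2.2)).afterFirst c))).sep
        (∀ q, i.2.2 (i.2.1 ⟨δ c (i.1 q), Set.mem_range_self _⟩) = f q))) using 1
  ext w
  simp only [Set.mem_union, Set.mem_iUnion, Set.mem_inter_iff, Set.mem_ofPred_eq, Prod.exists,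
    forall_mem_diff_iff]
  by_cases hw : c ∈ w
  · obtain ⟨v, z, rfl, hv⟩ := List.eq_append_cons_of_mem hw
    simp only [append_mem_beforeFirst hv, append_mem_afterFirst hv, Set.mem_inter_iff,
      Set.mem_ofPred_eq]
    have hrun : ∀ q, run δ (v ++ c :: z) q = lastMap δ c z
        ((run δ' (blockMaps δ c z) ⟨δ c (run δ v q), Set.mem_range_self _⟩ :
          Set.range (δ c)) : Q) := fun q => by
      rw [hval, ← run_eq_lastMap, run_append]
      rfl
    constructor
    · rintro ⟨hS, rfl⟩
      have hz : ∀ a ∈ z, a ∈ S := fun a ha => hS a (by simp [ha])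
      exact Or.inr ⟨_, _, _, fun q => (hrun q).symm, hS, ⟨⟨fun a ha => hS a (by simp [ha]), hv⟩, rfl⟩,
        ⟨hz, fun t ht => exists_run_of_mem_blockMaps hz ht, rfl⟩, hz, rfl⟩
    · rintro (⟨⟨-, h⟩, -⟩ | ⟨_, _, _, hf, hS, ⟨-, rfl⟩, ⟨-, -, rfl⟩, -, rfl⟩)
      · exact absurd hw h
      · exact ⟨hS, funext fun q => (hrun q).trans (hf q)⟩
  · constructor
    · rintro ⟨hS, rfl⟩
      exact Or.inl ⟨⟨hS, hw⟩, rfl⟩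
    · rintro (⟨⟨hS, -⟩, hf⟩ | ⟨_, _, _, -, -, ⟨v, z, rfl, -⟩, -⟩)
      · exact ⟨hS, hf⟩
      · simp at hw

/-- The automaton on the left quotients of an aperiodic language is counter-free. -/
theorem IsAperiodic.futureDefinable {A : Type u} [Finite A] {L : Set (List A)}
    (h : IsAperiodic L) : FutureDefinable L := by
  have := h.finite_quot.to_subtype
  let δ : A → Set.range (leftQuot L) → Set.range (leftQuot L) := fun a K =>
    ⟨leftQuot K.1 [a], by
      obtain ⟨x, hx⟩ := K.2
      exact ⟨x ++ [a], by ext y; simp [leftQuot, ← hx]⟩⟩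
  have hδ : ∀ w K, (run δ w K).1 = leftQuot K.1 w := fun w => by
    induction w with
    | nil => exact fun K => rfl
    | cons a v ih => exact fun K => (ih _).trans rfl
  have hcf : IsCounterFree δ Set.univ := by
    obtain ⟨n, hn⟩ := h.exists_pow
    refine ⟨n, fun u _ => ?_⟩
    funext ⟨_, x, rfl⟩
    rw [← run_wordPow, ← run_wordPow]
    apply Subtype.ext
    rw [hδ, hδ]
    ext y
    simpa [leftQuot] using (hn n le_rfl x u y).symm
  convert FutureDefinable.iUnion fun f : Set.range (leftQuot L) → Set.range (leftQuot L) =>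
    (FutureDefinable.run_eq δ Set.univ hcf f).sep ([] ∈ (f ⟨leftQuot L [], ⟨[], rfl⟩⟩).1) using 1
  ext w
  simp [hδ, leftQuot]

/-! ### Truth at the positions of a word -/

theorem last_wordModel_add_one {A : Type u} (e : A ↪ ℕ) {w : List A} (n : Fin w.length) :
    w.length = (wordModel e w).last + 1 :=
  (Nat.sub_add_cancel n.pos).symm

/-- Truth of a formula at a position of a word, positions being elements of `Fin w.length`, the
domain of the first-order structure of the word. -/
def SatAt {A : Type u} (e : A ↪ ℕ) (w : List A) (n : Fin w.length) (φ : LTLFormula) : Prop :=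
  (wordModel e w).Sat (n.cast (last_wordModel_add_one e n)) φ

section SatAt

variable {A : Type u} {e : A ↪ ℕ} {w : List A} {n : Fin w.length} {φ ψ : LTLFormula}

theorem satAt_top : SatAt e w n .top := trivial

theorem satAt_var {i : ℕ} : SatAt e w n (.var i) ↔ e (w.get n) = i := by
  change (∃ a, w[(n : ℕ)]? = some a ∧ e a = i) ↔ _
  simp

theorem satAt_neg : SatAt e w n (.neg φ) ↔ ¬ SatAt e w n φ := Iff.rfl

theorem satAt_and : SatAt e w n (.and φ ψ) ↔ SatAt e w n φ ∧ SatAt e w n ψ := Iff.rfl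

theorem satAt_next :
    SatAt e w n (.next φ) ↔ ∃ h : (n : ℕ) + 1 < w.length, SatAt e w ⟨n + 1, h⟩ φ := by
  have h : w.length = (wordModel e w).last + 1 := last_wordModel_add_one e n
  constructor
  · rintro ⟨h', hs⟩
    rw [Fin.val_cast] at h'
    exact ⟨by omega, hs⟩
  · rintro ⟨h', hs⟩
    refine ⟨?_, hs⟩
    rw [Fin.val_cast]
    omega

theorem satAt_eventually : SatAt e w n (.eventually φ) ↔ ∃ m, n < m ∧ SatAt e w m φ :=
  (finCongr (last_wordModel_add_one e n)).surjective.exists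

theorem satAt_until : SatAt e w n (.until φ ψ) ↔
    ∃ m, n < m ∧ SatAt e w m φ ∧ ∀ k, n < k → k < m → SatAt e w k ψ :=
  (finCongr (last_wordModel_add_one e n)).surjective.exists.trans <| exists_congr fun _ =>
    and_congr_right fun _ => and_congr_right fun _ =>
      (finCongr (last_wordModel_add_one e n)).surjective.forall

theorem sat_zero_iff (hw : w ≠ []) :
    (wordModel e w).Sat 0 φ ↔ SatAt e w ⟨0, List.length_pos_iff.2 hw⟩ φ := Iff.rfl

end SatAt

/-! ### From future definability to temporal formulas -/

theorem holdsUntil_iff {A : Type*} {L K : Set (List A)} {w : List A} :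
    HoldsUntil L K w ↔ ∃ k ≤ w.length, w.drop k ∈ L ∧ ∀ j < k, w.drop j ∈ K := by
  induction w with
  | nil => simp [HoldsUntil]
  | cons a v ih =>
    simp only [HoldsUntil, ih]
    constructor
    · rintro (h | ⟨h, k, hk, hL, hK⟩)
      · exact ⟨0, by simp, h, by simp⟩
      · refine ⟨k + 1, by simpa using hk, hL, fun j hj => ?_⟩
        cases j with
        | zero => exact h
        | succ j => exact hK j (by omega)
    · rintro ⟨k, hk, hL, hK⟩
      cases k with
      | zero => exact Or.inl hL
      | succ k =>
        exact Or.inr ⟨hK 0 (by omega), k, by simpa using hk, hL,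
          fun j hj => hK (j + 1) (by omega)⟩

/-- Whether the empty word belongs to the language decides what "next" and "until" have to say
about the end of the word. -/
theorem FutureDefinable.exists_formula {A : Type u} (e : A ↪ ℕ) {L : Set (List A)}
    (hL : FutureDefinable L) :
    ∃ φ : LTLFormula, ∀ (w : List A) (n : Fin w.length), SatAt e w n φ ↔ w.drop n ∈ L := by
  induction hL with
  | univ => exact ⟨.top, fun w n => iff_of_true satAt_top trivial⟩
  | letter a =>
    refine ⟨.var (e a), fun w n => ?_⟩
    rw [satAt_var, e.injective.eq_iff, Set.mem_ofPred_eq, List.head?_drop]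
    simp
  | compl _ ih =>
    obtain ⟨φ, h⟩ := ih
    exact ⟨.neg φ, fun w n => not_congr (h w n)⟩
  | inter _ _ ih ih' =>
    obtain ⟨φ, h⟩ := ih
    obtain ⟨ψ, h'⟩ := ih'
    exact ⟨.and φ ψ, fun w n => and_congr (h w n) (h' w n)⟩
  | @next L _ ih =>
    obtain ⟨φ, h⟩ := ih
    have hd : ∀ (w : List A) (n : Fin w.length),
        w.drop n ∈ {w | ∃ a v, w = a :: v ∧ v ∈ L} ↔ w.drop (n + 1) ∈ L := fun w n => by
      rw [List.drop_eq_getElem_cons n.2]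
      exact ⟨fun ⟨_, _, h, hv⟩ => (List.cons.inj h).2 ▸ hv, fun hv => ⟨_, _, rfl, hv⟩⟩
    by_cases hnil : [] ∈ L
    · -- `○ φ`, or there is no next moment
      refine ⟨.neg (.next (.neg φ)), fun w n => ?_⟩
      rw [hd, satAt_neg, satAt_next]
      simp only [satAt_neg, h]
      by_cases hn : (n : ℕ) + 1 < w.length
      · simp [hn]
      · simp [hn, List.drop_eq_nil_of_le (not_lt.1 hn), hnil]
    · refine ⟨.next φ, fun w n => ?_⟩
      rw [hd, satAt_next]
      simp only [h]
      by_cases hn : (n : ℕ) + 1 < w.length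
      · simp [hn]
      · simp [hn, List.drop_eq_nil_of_le (not_lt.1 hn), hnil]
  | @untl L K _ _ ih ih' =>
    obtain ⟨φ, h⟩ := ih
    obtain ⟨ψ, h'⟩ := ih'
    have hd : ∀ (w : List A) (n : Fin w.length), HoldsUntil L K (w.drop n) ↔
        w.drop n ∈ L ∨ (w.drop n ∈ K ∧
          ((∃ m : Fin w.length, n < m ∧ w.drop m ∈ L ∧
            ∀ k : Fin w.length, n < k → k < m → w.drop k ∈ K) ∨
          ([] ∈ L ∧ ¬ ∃ k : Fin w.length, n < k ∧ w.drop k ∉ K))) := fun w n => by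
      rw [holdsUntil_iff]
      simp only [List.drop_drop, List.length_drop]
      constructor
      · rintro ⟨k, hk, hL, hK⟩
        rcases k with _ | k
        · exact Or.inl hL
        refine Or.inr ⟨hK 0 (by omega), ?_⟩
        by_cases hkw : n + (k + 1) < w.length
        · refine Or.inl ⟨⟨n + (k + 1), hkw⟩, Fin.lt_def.2 (by simp only; omega), hL, fun j hnj hj => ?_⟩
          have := hK (j - n) (by rw [Fin.lt_def] at hj hnj; simp only at hj; omega)
          rwa [show (n : ℕ) + (j - n) = j by rw [Fin.lt_def] at hnj; omega] at this
        · rw [List.drop_eq_nil_of_le (by omega)] at hL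
          refine Or.inr ⟨hL, ?_⟩
          rintro ⟨j, hnj, hj⟩
          refine hj ?_
          have := hK (j - n) (by have := j.2; omega)
          rwa [show (n : ℕ) + (j - n) = j by rw [Fin.lt_def] at hnj; omega] at this
      · rintro (hL | ⟨hn, ⟨m, hnm, hL, hK⟩ | ⟨hL, hK⟩⟩)
        · exact ⟨0, by omega, hL, by simp⟩
        · rw [Fin.lt_def] at hnm
          refine ⟨m - n, by have := m.2; omega, ?_, fun j hj => ?_⟩
          · rwa [show (n : ℕ) + (m - n) = m by omega]
          · rcases j with _ | j
            · exact hn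
            · exact hK ⟨n + (j + 1), by have := m.2; omega⟩ (Fin.lt_def.2 (by simp only; omega))
                (Fin.lt_def.2 (by simp only; omega))
        · refine ⟨w.length - n, le_rfl, ?_, fun j hj => ?_⟩
          · rwa [List.drop_eq_nil_of_le (by omega)]
          · rcases j with _ | j
            · exact hn
            · by_contra hj'
              exact hK ⟨⟨n + (j + 1), by omega⟩, Fin.lt_def.2 (by simp only; omega), hj'⟩
    let or (φ ψ : LTLFormula) : LTLFormula := .neg (.and (.neg φ) (.neg ψ))
    have hor : ∀ φ ψ w n, SatAt e w n (or φ ψ) ↔ SatAt e w n φ ∨ SatAt e w n ψ :=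
      fun φ ψ w n => by simp only [or, satAt_neg, satAt_and]; tauto
    by_cases hnil : [] ∈ L
    · refine ⟨or φ (.and ψ (or (.until φ ψ) (.neg (.eventually (.neg ψ))))), fun w n => ?_⟩
      rw [Set.mem_ofPred_eq, hd]
      simp only [hor, satAt_and, satAt_until, satAt_neg, satAt_eventually, h, h', hnil, true_and]
    · refine ⟨or φ (.and ψ (.until φ ψ)), fun w n => ?_⟩
      rw [Set.mem_ofPred_eq, hd]
      simp only [hor, satAt_and, satAt_until, h, h', hnil, false_and, or_false]

/-! ### From temporal formulas to first-order formulas -/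

/-- A property of words with distinguished positions that is expressed by one first-order formula
with the free variables `α`. -/
def FODefinableProp {A : Type u} {α : Type} (P : ∀ w : List A, (α → Fin w.length) → Prop) : Prop :=
  ∃ φ : (wordSignature A).Formula α, ∀ (w : List A) (v : α → Fin w.length), φ.Realize v ↔ P w v

namespace FODefinableProp

variable {A : Type u} {α : Type}

theorem false : FODefinableProp (A := A) (α := α) fun _ _ => False :=
  ⟨⊥, fun _ _ => Iff.rfl⟩

theorem not {P : ∀ w : List A, (α → Fin w.length) → Prop} (h : FODefinableProp P) :
    FODefinableProp fun w v => ¬ P w v :=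
  let ⟨φ, hφ⟩ := h
  ⟨φ.not, fun w v => Language.Formula.realize_not.trans (not_congr (hφ w v))⟩

theorem and {P P' : ∀ w : List A, (α → Fin w.length) → Prop} (h : FODefinableProp P)
    (h' : FODefinableProp P') : FODefinableProp fun w v => P w v ∧ P' w v :=
  let ⟨φ, hφ⟩ := h
  let ⟨ψ, hψ⟩ := h'
  ⟨φ ⊓ ψ, fun w v => Language.Formula.realize_inf.trans (and_congr (hφ w v) (hψ w v))⟩

theorem exists_position {P : ∀ w : List A, (α → Fin w.length) → Fin w.length → Prop}
    (h : FODefinableProp (α := Option α) fun w v => P w (fun a => v (some a)) (v none)) :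
    FODefinableProp fun w v => ∃ m, P w v m := by
  obtain ⟨φ, hφ⟩ := h
  refine ⟨Language.Formula.iExs Unit
    (φ.relabel fun o : Option α => o.elim (Sum.inr ()) Sum.inl), fun w v => ?_⟩
  rw [Language.Formula.realize_iExs]
  simp only [Language.Formula.realize_relabel, hφ]
  exact ⟨fun ⟨i, hi⟩ => ⟨i (), hi⟩, fun ⟨m, hm⟩ => ⟨fun _ => m, hm⟩⟩

theorem lt (x y : α) : FODefinableProp (A := A) fun _ v => v x < v y :=
  ⟨Language.Relations.formula₂ (L := wordSignature A) (WordRel.lt : WordRel A 2)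
    (Language.Term.var x) (Language.Term.var y), fun w v => by
    simp [Language.Structure.RelMap, WordRel.Holds]⟩

theorem letter (a : A) (x : α) : FODefinableProp (A := A) fun w v => w.get (v x) = a :=
  ⟨Language.Relations.formula₁ (L := wordSignature A) (WordRel.letter a)
    (Language.Term.var x), fun w v => by
    simp [Language.Structure.RelMap, WordRel.Holds]⟩

theorem satAt (e : A ↪ ℕ) (φ : LTLFormula) (x : α) :
    FODefinableProp fun w v => SatAt e w (v x) φ := by
  induction φ generalizing α with
  | top => simpa [satAt_top] using (false (A := A) (α := α)).not
  | var i =>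
    simp only [satAt_var]
    by_cases hi : ∃ a, e a = i
    · obtain ⟨a, rfl⟩ := hi
      simpa using letter a x
    · convert false (A := A) (α := α) using 3
      exact iff_of_false (fun h => hi ⟨_, h⟩) id
  | neg φ ih => exact (ih x).not
  | and φ ψ ih ih' => exact (ih x).and (ih' x)
  | next φ ih =>
    -- The next position is the later one with nothing in between.
    have : FODefinableProp (A := A) fun w (v : α → Fin w.length) =>
        ∃ m, v x < m ∧ (¬ ∃ k, v x < k ∧ k < m) ∧ SatAt e w m φ :=
      exists_position ((lt _ _).and (.and (.not (exists_position
        ((lt (some (some x)) none).and (lt none (some none))))) (ih _)))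
    convert this using 3 with w v
    rw [satAt_next]
    constructor
    · rintro ⟨h, hs⟩
      refine ⟨_, Fin.lt_def.2 (Nat.lt_succ_self _), ?_, hs⟩
      rintro ⟨k, hk, hk'⟩
      rw [Fin.lt_def] at hk hk'
      simp only at hk'
      omega
    · rintro ⟨m, hm, hk, hs⟩
      have hm' : (v x : ℕ) + 1 = m := by
        by_contra hne
        rw [Fin.lt_def] at hm
        exact hk ⟨⟨v x + 1, by omega⟩, Fin.lt_def.2 (Nat.lt_succ_self _),
          Fin.lt_def.2 (by simp only; omega)⟩
      refine ⟨hm' ▸ m.2, ?_⟩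
      convert hs
  | eventually φ ih =>
    simp only [satAt_eventually]
    exact exists_position ((lt _ _).and (ih _))
  | _ φ ψ ih ih' =>
    -- the remaining case: `φ 𝒰 ψ`
    have : FODefinableProp (A := A) fun w (v : α → Fin w.length) =>
        ∃ m, v x < m ∧ SatAt e w m φ ∧ ¬ ∃ k, v x < k ∧ k < m ∧ ¬ SatAt e w k ψ :=
      exists_position ((lt _ _).and (.and (ih _) (.not (exists_position
        ((lt (some (some x)) none).and ((lt none (some none)).and (ih' _).not))))))
    simpa [satAt_until] using this

end FODefinableProp

theorem mainTheorem6 {A : Type*} [Finite A] (e : A ↪ ℕ) (L : Language A)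
    (hL : ∀ w ∈ L, w ≠ []) :
    IsFODefinable L ↔ IsLTLDefinable e L := by
  constructor
  · rintro ⟨φ, rfl⟩
    obtain ⟨ψ, hψ⟩ := (isAperiodic_setOf_wordModels φ).futureDefinable.exists_formula e
    refine ⟨ψ, Set.ext fun w => and_congr_right fun hw => ?_⟩
    rw [sat_zero_iff hw, hψ]
    exact Iff.rfl
  · rintro ⟨φ, rfl⟩
    obtain ⟨ψ, hψ⟩ : FODefinableProp (A := A) (α := Empty) fun w _ =>
        ∃ m, (¬ ∃ k, k < m) ∧ SatAt e w m φ :=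
      .exists_position (.and (.not (.exists_position (.lt none (some none)))) (.satAt e φ none))
    refine ⟨ψ, Set.ext fun w => and_congr_right fun hw => ?_⟩
    rw [sat_zero_iff hw]
    refine Iff.trans ?_ (hψ w _).symm
    constructor
    · exact fun h => ⟨_, by rintro ⟨k, hk⟩; exact Nat.not_lt_zero _ hk, h⟩
    · rintro ⟨m, hm, hs⟩
      convert hs
      by_contra hne
      exact hm ⟨⟨0, m.pos⟩, Fin.lt_def.2 (by simp only; omega)⟩
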